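/- Let $s\le m$ and $n$ be positive integers. The uniform sparse JL distribution $\mathcal A_{s,m}$ over $m\times n$ real matrices is the law of $A$ with entries $A_{r,i}=\eta_{r,i}\sigma_{r,i}/\sqrt s$, where the $\sigma_{r,i}$ are i.i.d. uniform $\pm1$ variables, independent of the $\eta_{r,i}\in\{0,1\}$; the columns $(\eta_{r,i})_{r\in[m]}$ are independent over $i\in[n]$, and in each column a uniformly random set of exactly $s$ of the $m$ entries $\eta_{r,i}$ is equal to $1$, the others being $0$. For $0\le v\le 1$ put $S_v^{(n)}=\{x\in\mathbb R^n:\|x\|_\infty\le v\|x\|_2\}$. For $\epsilon,\delta>0$ let $v_n(m,\epsilon,\delta,s)$ be the supremum of all $v\in[0,1]$ such that $$\mathbb P_{A\sim\mathcal A_{s,m}}\big[(1-\epsilon)\|x\|_2\le\|Ax\|_2\le(1+\epsilon)\|x\|_2\big]>1-\delta\qquad\text{for all }x\in S_v^{(n)},$$ and let $v(m,\epsilon,\delta,s)$ be the supremum of all $v\in[0,1]$ for which this holds for every $n$. There exist absolute constants $C_\epsilon,C_\delta,C,C_S,C_L,C_T>0$ such that, whenever $0<\epsilon<C_\epsilon$,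 $0<\delta<C_\delta$, $s\le m$ are positive integers with $C\le s\le C_S\,\epsilon^{-1}\log(1/\delta)$, and $$m\le\min\left(\epsilon^{-2}e^{C_T\log(1/\delta)},\ \epsilon^{-2}\log(1/\delta)\,e^{\frac{C_L\log(1/\delta)\,\epsilon^{-1}}{s}}\right),$$ we have $v(m,\epsilon,\delta,s)\le 1/2$; moreover $v_n(m,\epsilon,\delta,s)\le 1/2$ for all sufficiently large ambient dimensions $n$ (depending on $m,\epsilon,\delta,s$). -/

import Mathlib

open MeasureTheory ProbabilityTheory Matrix Filter

noncomputable section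

namespace SparseJL

/-- The sample space of the uniform sparse JL distribution with `s` nonzero entries per column:
for every column `i : Fin n` a set of exactly `s` of the `m` rows, together with a sign for every
position `(r, i)`. -/
def Sample (n m s : ℕ) : Type :=
  (Fin n → {S : Finset (Fin m) // S.card = s}) × (Fin m → Fin n → ℤˣ)

instance (n m s : ℕ) : Fintype (Sample n m s) :=
  inferInstanceAs (Fintype ((Fin n → {S : Finset (Fin m) // S.card = s}) × (Fin m → Fin n → ℤˣ)))

instance (n m s : ℕ) : MeasurableSpace (Sample n m s) := ⊤

/-- The uniform probability on the sample space. The sample space is a product, so the columns'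
supports and the signs are all independent; every support is a uniformly random `s`-element subset
of the rows and every sign is a Rademacher variable. (It is a probability measure if `s ≤ m`.) -/
def prob (n m s : ℕ) : Measure (Sample n m s) := uniformOn Set.univ

variable {n m s : ℕ}

/-- The selector `η_{r,i}`: it is `1` if row `r` is in the support of column `i`, else `0`. -/
def eta (ω : Sample n m s) (r : Fin m) (i : Fin n) : ℝ :=
  if r ∈ (ω.1 i).1 then 1 else 0

/-- The Rademacher sign `σ_{r,i}`. -/
def sigma (ω : Sample n m s) (r : Fin m) (i : Fin n) : ℝ :=
  ((ω.2 r i : ℤ) : ℝ)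

/-- The random `m × n` matrix with entries `η_{r,i} σ_{r,i} / √s`; its law under `prob n m s` is
the uniform sparse JL distribution. -/
def randMatrix (ω : Sample n m s) : Matrix (Fin m) (Fin n) ℝ :=
  Matrix.of fun r i => eta ω r i * sigma ω r i / √(s : ℝ)

/-- The norm-preservation condition for a random matrix `A` at the vector `x`:
`P[(1 - ε) ‖x‖₂ ≤ ‖A x‖₂ ≤ (1 + ε) ‖x‖₂] > 1 - δ`. -/
def JLCondition {Ω : Type*} [MeasurableSpace Ω] {n m : ℕ} (P : Measure Ω)
    (A : Ω → Matrix (Fin m) (Fin n) ℝ) (ε δ : ℝ) (x : EuclideanSpace ℝ (Fin n)) : Prop :=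
  P.real {ω | (1 - ε) * ‖x‖ ≤ ‖WithLp.toLp 2 (A ω *ᵥ x.ofLp)‖ ∧
    ‖WithLp.toLp 2 (A ω *ᵥ x.ofLp)‖ ≤ (1 + ε) * ‖x‖} > 1 - δ

/-- `S_v`: the vectors of `ℝⁿ` with `‖x‖_∞ / ‖x‖₂ ≤ v`. (`x.ofLp` is `x` as an element of
`Fin n → ℝ`, whose norm is the sup norm; the zero vector belongs to `S_v` for `v ≥ 0`.) -/
def ratioSet (n : ℕ) (v : ℝ) : Set (EuclideanSpace ℝ (Fin n)) :=
  {x | ‖x.ofLp‖ / ‖x‖ ≤ v}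

/-- The supremum over all `0 ≤ v ≤ 1` such that the norm-preservation condition holds on
`S_v ⊆ ℝⁿ` for the uniform sparse JL distribution over `m × n` matrices with sparsity `s`,
for a fixed ambient dimension `n`. -/
def thresholdIn (n m : ℕ) (ε δ : ℝ) (s : ℕ) : ℝ :=
  sSup {v : ℝ | 0 ≤ v ∧ v ≤ 1 ∧
    ∀ x ∈ ratioSet n v, JLCondition (prob n m s) randMatrix ε δ x}

/-- `v(m, ε, δ, s)`: the supremum over all `0 ≤ v ≤ 1` such that the norm-preservation condition
holds on `S_v`, in every ambient dimension `n`, for the uniform sparse JL distribution with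
dimension `m` and sparsity `s`. -/
def threshold (m : ℕ) (ε δ : ℝ) (s : ℕ) : ℝ :=
  sSup {v : ℝ | 0 ≤ v ∧ v ≤ 1 ∧
    ∀ n : ℕ, ∀ x ∈ ratioSet n v, JLCondition (prob n m s) randMatrix ε δ x}

end SparseJL

end

/-! Norm preservation must fail with probability at least `δ` at one vector of $S_{1/2}$. Indicators
of at least four coordinates lie there. For the indicator of $K$, the integer `energy` $= s\|Ax\|^2$
equals $|K|s$ plus signed contributions of collisions, that is, rows shared by two columns of $K$.
It suffices that collisions with equal signs push it above $|K|s(1+\epsilon)^2$ often enough. Put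
$L=\log(1/\delta)$.

If $\epsilon s$ is small, one collision is enough. For $m\ge 16s^2$ take $k\approx\min(1/(3\epsilon
s),\sqrt m/s)$ coordinates: an aligned collision raises the energy by at least
$1>ks(2\epsilon+\epsilon^2)$, and its probability is of order $k^2s^2/m\gtrsim e^{-L/2}$
(`le_card_few_collisions`, `not_jlCondition_many`). For $m<16s^2$ two columns collide with constant
probability, and four coordinates suffice.

Otherwise take four coordinates and ask two columns to share $t\approx 6\epsilon s$ rows. The second
moment method (`le_card_inter_ge`) bounds this probability below by $(\mu/(4(1+\mu)))^t$ with
$\mu\approx s^2/(tm)$; aligning the signs costs $2^{-t}/8$ (`card_signs_of_inter`). The bound on $m$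
keeps the product above `δ`.

All probabilities are handled as counts over finite sets. -/

open MeasureTheory ProbabilityTheory Matrix Filter

/-! ### Random supports: superset counts and the tail of an intersection. -/

namespace SparseJL

/-- The supports of a column: subsets of the rows with exactly `s` elements. -/
abbrev Support (m s : ℕ) : Type := {S : Finset (Fin m) // S.card = s}

theorem card_support (m s : ℕ) : Fintype.card (Support m s) = m.choose s := by
  simp [Support]

theorem card_support_pos {m s : ℕ} (h : s ≤ m) : (0 : ℝ) < Fintype.card (Support m s) := by
  rw [card_support]; exact_mod_cast Nat.choose_pos h

theorem card_supersets {m s : ℕ} (U : Finset (Fin m)) (hU : U.card ≤ s) :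
    (Finset.univ.filter fun S : Support m s => U ⊆ S.1).card =
      (m - U.card).choose (s - U.card) := by
  have h1 : (Finset.powersetCard (s - U.card) Uᶜ).card = (m - U.card).choose (s - U.card) := by
    rw [Finset.card_powersetCard, Finset.card_compl, Fintype.card_fin]
  rw [← h1]
  refine Finset.card_bij (fun S _ => S.1 \ U) ?_ ?_ ?_
  · intro S hS
    simp only [Finset.mem_filter, Finset.mem_univ, true_and] at hS
    rw [Finset.mem_powersetCard]
    refine ⟨fun r hr => ?_, ?_⟩
    · simp only [Finset.mem_sdiff] at hr
      simpa using hr.2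
    · rw [Finset.card_sdiff_of_subset hS, S.2]
  · intro S hS S' hS' h
    simp only [Finset.mem_filter, Finset.mem_univ, true_and] at hS hS'
    apply Subtype.ext
    rw [← Finset.sdiff_union_of_subset hS, h, Finset.sdiff_union_of_subset hS']
  · intro V hV
    rw [Finset.mem_powersetCard] at hV
    have hd : Disjoint V U := by
      rw [Finset.disjoint_left]
      intro r hr hrU
      exact (Finset.mem_compl.1 (hV.1 hr)) hrU
    refine ⟨⟨V ∪ U, ?_⟩, ?_, ?_⟩
    · rw [Finset.card_union_of_disjoint hd, hV.2]; omega
    · simp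
    · simp only [Finset.union_sdiff_right]
      exact Finset.sdiff_eq_self_of_disjoint hd

theorem choose_sub_succ {m s u : ℕ} (hu : u < s) (hs : s ≤ m) :
    ((m : ℝ) - u) * (m - (u + 1)).choose (s - (u + 1)) = (s - u) * (m - u).choose (s - u) := by
  obtain ⟨a, rfl⟩ : ∃ a, s = u + 1 + a := ⟨s - (u + 1), by omega⟩
  obtain ⟨c, rfl⟩ : ∃ c, m = u + 1 + c := ⟨m - (u + 1), by omega⟩
  have e1 : u + 1 + c - (u + 1) = c := by omega
  have e2 : u + 1 + a - (u + 1) = a := by omega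
  have e3 : u + 1 + c - u = c + 1 := by omega
  have e4 : u + 1 + a - u = a + 1 := by omega
  rw [e1, e2, e3, e4]
  have := Nat.add_one_mul_choose_eq c a
  have h : ((c : ℝ) + 1) * c.choose a = (c + 1).choose (a + 1) * (a + 1) := by exact_mod_cast this
  push_cast
  linear_combination h

/-- Each additional prescribed row costs a factor $(s-u)/(m-u)$, at most $s/m$. The companion lower
bound $s/(2m)$ holds while at most half of the support is prescribed. -/
theorem choose_sub_le {m s u : ℕ} (hu : u ≤ s) (hs : s ≤ m) (hm : 0 < m) :
    ((m - u).choose (s - u) : ℝ) ≤ ((s : ℝ) / m) ^ u * m.choose s := by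
  induction u with
  | zero => simp
  | succ u ih =>
    have h1 := choose_sub_succ (u := u) (by omega) hs
    have ih := ih (by omega)
    have hm' : (0 : ℝ) < m := by exact_mod_cast hm
    have hus : (u : ℝ) + 1 ≤ s := by exact_mod_cast hu
    have hsm : (s : ℝ) ≤ m := by exact_mod_cast hs
    have hmu : (0 : ℝ) < m - u := by linarith
    have h2 : ((m - (u + 1)).choose (s - (u + 1)) : ℝ) =
        (s - u) / (m - u) * (m - u).choose (s - u) := by
      field_simp; linear_combination h1
    have h3 : ((s : ℝ) - u) / (m - u) ≤ s / m := by
      rw [div_le_div_iff₀ hmu hm']; nlinarith [(Nat.cast_nonneg u : (0 : ℝ) ≤ u)]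
    rw [h2, pow_succ', mul_assoc]
    gcongr

theorem le_choose_sub {m s u : ℕ} (hu : 2 * u ≤ s) (hs : s ≤ m) (hm : 0 < m) :
    ((s : ℝ) / (2 * m)) ^ u * m.choose s ≤ (m - u).choose (s - u) := by
  induction u with
  | zero => simp
  | succ u ih =>
    have h1 := choose_sub_succ (u := u) (by omega) hs
    have ih := ih (by omega)
    have hm' : (0 : ℝ) < m := by exact_mod_cast hm
    have hus : 2 * ((u : ℝ) + 1) ≤ s := by exact_mod_cast hu
    have hsm : (s : ℝ) ≤ m := by exact_mod_cast hs
    have hu0 : (0 : ℝ) ≤ u := Nat.cast_nonneg u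
    have hmu : (0 : ℝ) < m - u := by linarith
    have h2 : ((m - (u + 1)).choose (s - (u + 1)) : ℝ) =
        (s - u) / (m - u) * (m - u).choose (s - u) := by
      field_simp; linear_combination h1
    have h3 : (s : ℝ) / (2 * m) ≤ (s - u) / (m - u) := by
      rw [div_le_div_iff₀ (by positivity) hmu]; nlinarith
    rw [h2, pow_succ', mul_assoc]
    gcongr
    exact div_nonneg (by linarith) hmu.le

theorem card_supersets_le {m s : ℕ} (hs : s ≤ m) (hm : 0 < m) (U : Finset (Fin m)) :
    ((Finset.univ.filter fun S : Support m s => U ⊆ S.1).card : ℝ) ≤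
      ((s : ℝ) / m) ^ U.card * Fintype.card (Support m s) := by
  rw [card_support]
  by_cases hU : U.card ≤ s
  · rw [card_supersets U hU]
    exact choose_sub_le hU hs hm
  · have : (Finset.univ.filter fun S : Support m s => U ⊆ S.1) = ∅ := by
      ext S
      simp only [Finset.mem_filter, Finset.mem_univ, true_and, Finset.notMem_empty, iff_false]
      intro h
      exact hU (S.2 ▸ Finset.card_le_card h)
    rw [this]
    simp only [Finset.card_empty, Nat.cast_zero]
    positivity

theorem le_card_supersets {m s : ℕ} (hs : s ≤ m) (hm : 0 < m) (U : Finset (Fin m))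
    (hU : 2 * U.card ≤ s) :
    ((s : ℝ) / (2 * m)) ^ U.card * Fintype.card (Support m s) ≤
      (Finset.univ.filter fun S : Support m s => U ⊆ S.1).card := by
  rw [card_support, card_supersets U (by omega)]
  exact le_choose_sub hU hs hm

theorem card_supersets_singleton {m s : ℕ} (hs : s ≤ m) (hs0 : 0 < s) (r : Fin m) :
    ((Finset.univ.filter fun S : Support m s => r ∈ S.1).card : ℝ) =
      (s : ℝ) / m * Fintype.card (Support m s) := by
  have h := card_supersets (s := s) {r} (by rw [Finset.card_singleton]; omega)
  simp only [Finset.singleton_subset_iff, Finset.card_singleton] at h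
  have h1 := choose_sub_succ (u := 0) hs0 hs
  have hm' : (m : ℝ) ≠ 0 := by
    have : 0 < m := by omega
    positivity
  rw [h, card_support]
  simp only [Nat.cast_zero, sub_zero, zero_add, Nat.sub_zero] at h1
  field_simp
  linear_combination h1

/-- Cauchy-Schwarz form of the second moment method on a finite type. -/
theorem sq_sum_le_card_mul_sum_sq {α : Type*} [Fintype α] (X : α → ℝ) (P : α → Prop)
    [DecidablePred P] (hP : ∀ a, X a ≠ 0 → P a) :
    (∑ a, X a) ^ 2 ≤ (Finset.univ.filter P).card * ∑ a, X a ^ 2 := by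
  have h1 : ∑ a, X a = ∑ a ∈ Finset.univ.filter P, X a := by
    rw [Finset.sum_filter]
    refine Finset.sum_congr rfl fun a _ => ?_
    split_ifs with h
    · rfl
    · by_contra h'; exact h (hP a h')
  rw [h1]
  refine _root_.sq_sum_le_card_mul_sum_sq.trans ?_
  gcongr
  exact Finset.subset_univ _

theorem prod_boole_of_iff {ι : Type*} [Fintype ι] (P : ι → Prop) [DecidablePred P] (Q : Prop)
    [Decidable Q] (h : (∀ a, P a) ↔ Q) :
    (∏ a, if P a then (1 : ℝ) else 0) = if Q then 1 else 0 := by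
  by_cases hQ : Q
  · simp [hQ, h.2 hQ]
  · rw [if_neg hQ]
    have : ∃ a, ¬ P a := by
      by_contra! h'
      exact hQ (h.1 h')
    obtain ⟨a, ha⟩ := this
    exact Finset.prod_eq_zero (Finset.mem_univ a) (if_neg ha)

/-- Second moment of the number of ways to pick one support row from each of `t` disjoint blocks of
size `b`. The square expands over two picks per block. -/
theorem sum_prod_sq_le {m s t b : ℕ} (hs : s ≤ m) (hm : 0 < m) (e : Fin t × Fin b → Fin m)
    (he : Function.Injective e) :
    ∑ S : Support m s, (∏ a, ∑ c, if e (a, c) ∈ S.1 then (1 : ℝ) else 0) ^ 2 ≤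
      ((b : ℝ) * s / m * (1 + b * s / m)) ^ t * Fintype.card (Support m s) := by
  have key : ∀ S : Support m s, (∏ a, ∑ c, if e (a, c) ∈ S.1 then (1 : ℝ) else 0) ^ 2 =
      ∑ f : Fin t → Fin b × Fin b,
        if (Finset.univ.biUnion fun a => {e (a, (f a).1), e (a, (f a).2)}) ⊆ S.1
          then (1 : ℝ) else 0 := by
    intro S
    rw [← Finset.prod_pow]
    have : ∀ a, (∑ c, if e (a, c) ∈ S.1 then (1 : ℝ) else 0) ^ 2 =
        ∑ q : Fin b × Fin b, if e (a, q.1) ∈ S.1 ∧ e (a, q.2) ∈ S.1 then (1 : ℝ) else 0 := by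
      intro a
      rw [sq, Finset.sum_mul_sum, ← Finset.sum_product']
      refine Finset.sum_congr rfl fun q _ => ?_
      split_ifs <;> simp_all
    rw [Finset.prod_congr rfl fun a _ => this a, Finset.prod_univ_sum, Fintype.piFinset_univ]
    refine Finset.sum_congr rfl fun f _ => ?_
    refine prod_boole_of_iff _ _ ?_
    simp [Finset.insert_subset_iff]
  rw [Finset.sum_congr rfl fun S _ => key S, Finset.sum_comm]
  set p : ℝ := (s : ℝ) / m with hp
  have hp0 : 0 ≤ p := by positivity
  -- The blocks are disjoint, so the bound factors over them: coinciding picks cost `p`, distinct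
  -- ones `p ^ 2`.
  have hcard : ∀ f : Fin t → Fin b × Fin b,
      p ^ (Finset.univ.biUnion fun a => {e (a, (f a).1), e (a, (f a).2)}).card =
        ∏ a, if (f a).1 = (f a).2 then p else p ^ 2 := by
    intro f
    rw [Finset.card_biUnion, ← Finset.prod_pow_eq_pow_sum]
    · refine Finset.prod_congr rfl fun a _ => ?_
      split_ifs with h
      · simp [h]
      · rw [Finset.card_pair]
        intro h'
        exact h (congrArg Prod.snd (he h'))
    · intro a _ a' _ haa'
      refine Finset.disjoint_left.2 fun r hr hr' => ?_
      simp only [Finset.mem_insert, Finset.mem_singleton] at hr hr'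
      rcases hr with rfl | rfl <;> rcases hr' with h | h <;>
        exact haa' (congrArg Prod.fst (he h))
  calc _ ≤ ∑ f : Fin t → Fin b × Fin b,
        (∏ a, if (f a).1 = (f a).2 then p else p ^ 2) * (Fintype.card (Support m s) : ℝ) := by
        refine Finset.sum_le_sum fun f _ => ?_
        rw [Finset.sum_boole, ← hcard f]
        exact card_supersets_le hs hm _
    _ = (∑ q : Fin b × Fin b, if q.1 = q.2 then p else p ^ 2) ^ t *
        Fintype.card (Support m s) := by
        rw [← Finset.sum_mul]
        congr 1
        have := Finset.prod_univ_sum (fun _ : Fin t => (Finset.univ : Finset (Fin b × Fin b)))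
          (fun _ q => if q.1 = q.2 then p else p ^ 2)
        rw [Fintype.piFinset_univ] at this
        rw [← this]
        simp
    _ ≤ _ := by
        have h0 : 0 ≤ ∑ q : Fin b × Fin b, if q.1 = q.2 then p else p ^ 2 :=
          Finset.sum_nonneg fun q _ => by split_ifs <;> positivity
        gcongr
        calc _ ≤ ∑ q : Fin b × Fin b, ((if q.1 = q.2 then p else 0) + p ^ 2) := by
              refine Finset.sum_le_sum fun q _ => ?_
              split_ifs
              · linarith [sq_nonneg p]
              · linarith
          _ = _ := by
              rw [Finset.sum_add_distrib, Fintype.sum_prod_type]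
              simp
              rw [hp]; ring

/-- The matching first moment: every choice of one row per block is a set of `t` rows, to which the
superset bound applies because `2 * t ≤ s`. -/
theorem le_sum_prod {m s t b : ℕ} (hs : s ≤ m) (hm : 0 < m) (ht : 2 * t ≤ s)
    (e : Fin t × Fin b → Fin m) (he : Function.Injective e) :
    ((b : ℝ) * s / (2 * m)) ^ t * Fintype.card (Support m s) ≤
    ∑ S : Support m s, ∏ a, ∑ c, if e (a, c) ∈ S.1 then (1 : ℝ) else 0 := by
  have key : ∀ S : Support m s, (∏ a, ∑ c, if e (a, c) ∈ S.1 then (1 : ℝ) else 0) =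
      ∑ f : Fin t → Fin b,
        if (Finset.univ.image fun a => e (a, f a)) ⊆ S.1 then (1 : ℝ) else 0 := by
    intro S
    rw [Finset.prod_univ_sum, Fintype.piFinset_univ]
    refine Finset.sum_congr rfl fun f _ => ?_
    refine prod_boole_of_iff _ _ ?_
    simp [Finset.image_subset_iff]
  have hcard : ∀ f : Fin t → Fin b, (Finset.univ.image fun a => e (a, f a)).card = t := by
    intro f
    rw [Finset.card_image_of_injective, Finset.card_univ, Fintype.card_fin]
    intro a a' h
    exact congrArg Prod.fst (he h)
  rw [Finset.sum_congr rfl fun S _ => key S, Finset.sum_comm]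
  calc _ = ∑ f : Fin t → Fin b, ((s : ℝ) / (2 * m)) ^ t * Fintype.card (Support m s) := by
        simp only [Finset.sum_const, Finset.card_univ, Fintype.card_fun, Fintype.card_fin,
          nsmul_eq_mul]
        push_cast
        rw [← mul_assoc, ← mul_pow, mul_div_assoc]
    _ ≤ _ := by
        refine Finset.sum_le_sum fun f _ => ?_
        rw [Finset.sum_boole]
        have := le_card_supersets hs hm (Finset.univ.image fun a => e (a, f a))
          (by rw [hcard f]; exact ht)
        rwa [hcard f] at this

/-- A lower bound for the upper tail of the intersection of a uniformly random `s`-subset with a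
fixed set of size at least `t * b`. -/
theorem le_card_inter_ge {m s t b : ℕ} (hs : s ≤ m) (hs0 : 0 < s) (ht : 2 * t ≤ s) (hb : 0 < b)
    (B : Finset (Fin m)) (hB : t * b ≤ B.card) :
    ((b : ℝ) * s / m / (4 * (1 + b * s / m))) ^ t * Fintype.card (Support m s) ≤
      (Finset.univ.filter fun S : Support m s => t ≤ (B ∩ S.1).card).card := by
  have hm : 0 < m := by omega
  -- `t` disjoint blocks of size `b` inside `B`; a support meeting every block meets `B` in at least
  -- `t` rows.
  obtain ⟨e0⟩ : Nonempty (Fin t × Fin b ↪ B) := by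
    apply Function.Embedding.nonempty_of_card_le
    simpa using hB
  set e : Fin t × Fin b → Fin m := fun q => (e0 q).1 with he_def
  have he : Function.Injective e := fun q q' h => e0.injective (Subtype.ext h)
  have hN := card_support_pos hs
  set N : ℝ := (Fintype.card (Support m s) : ℝ)
  have h1 := le_sum_prod hs hm ht e he
  have h2 := sum_prod_sq_le hs hm e he
  have h3 := sq_sum_le_card_mul_sum_sq
    (fun S : Support m s => ∏ a, ∑ c, if e (a, c) ∈ S.1 then (1 : ℝ) else 0)
    (fun S => t ≤ (B ∩ S.1).card) (by
      intro S hS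
      have hex : ∀ a, ∃ c, e (a, c) ∈ S.1 := by
        intro a
        by_contra! h
        exact hS (Finset.prod_eq_zero (Finset.mem_univ a) (by simp [h]))
      choose c hc using hex
      calc t = (Finset.univ.image fun a => e (a, c a)).card := by
            rw [Finset.card_image_of_injective, Finset.card_univ, Fintype.card_fin]
            intro a a' h
            exact congrArg Prod.fst (he h)
        _ ≤ _ := by
            apply Finset.card_le_card
            rw [Finset.image_subset_iff]
            intro a _
            exact Finset.mem_inter.2 ⟨(e0 _).2, hc a⟩)
  set M : ℝ := ((Finset.univ.filter fun S : Support m s => t ≤ (B ∩ S.1).card).card : ℝ)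
  have hm' : (0 : ℝ) < m := by exact_mod_cast hm
  have hs' : (0 : ℝ) < s := by exact_mod_cast hs0
  have hb' : (0 : ℝ) < b := by exact_mod_cast hb
  set μ : ℝ := (b : ℝ) * s / m with hμ
  have hμ0 : 0 < μ := by positivity
  have e1 : (b : ℝ) * s / (2 * m) = μ / 2 := by rw [hμ]; field_simp
  rw [e1] at h1
  have hM : 0 ≤ M := Nat.cast_nonneg _
  have h4 : ((μ / 2) ^ t * N) ^ 2 ≤ M * ((μ * (1 + μ)) ^ t * N) := by
    refine (pow_le_pow_left₀ (by positivity) h1 2).trans (h3.trans ?_)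
    gcongr
  -- The base of the bound is the first moment squared over the second moment, per block.
  have h5 : μ / (4 * (1 + μ)) = (μ / 2) ^ 2 / (μ * (1 + μ)) := by field_simp; norm_num
  rw [h5, div_pow, div_mul_eq_mul_div, div_le_iff₀ (by positivity)]
  refine le_of_mul_le_mul_right ?_ hN
  rw [← pow_mul, mul_comm 2 t, pow_mul]
  linarith [h4, show ((μ / 2) ^ t * N) ^ 2 = ((μ / 2) ^ t) ^ 2 * N * N by ring]

/-- Resampling one coordinate does not change the mean over a finite power. -/
theorem sum_sum_update {ι α : Type*} [Fintype ι] [DecidableEq ι] [Fintype α] (i : ι)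
    (g : (ι → α) → ℝ) :
    ∑ f : ι → α, ∑ a, g (Function.update f i a) = Fintype.card α * ∑ f, g f := by
  have h : ∀ g : (ι → α) → ℝ, ∑ f : ι → α, g f =
      ∑ q : α × ({j // j ≠ i} → α), g ((Equiv.funSplitAt i α).symm q) := fun g =>
    ((Equiv.funSplitAt i α).symm.sum_comp g).symm
  rw [h, h g, Fintype.sum_prod_type, Fintype.sum_prod_type]
  have : ∀ (a a' : α) (q : {j // j ≠ i} → α),
      Function.update ((Equiv.funSplitAt i α).symm (a, q)) i a' =
        (Equiv.funSplitAt i α).symm (a', q) := by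
    intro a a' q
    funext j
    by_cases hj : j = i
    · subst hj; simp
    · simp [hj]
  simp only [this, Finset.sum_const, Finset.card_univ, nsmul_eq_mul]
  rw [Finset.sum_comm]

/-- Conditioning on all coordinates but `i`: a uniform lower bound on the conditional probability
bounds the total one. -/
theorem le_card_of_update {ι α : Type*} [Fintype ι] [DecidableEq ι] [Fintype α] [Nonempty α]
    (i : ι) (P : (ι → α) → Prop) [DecidablePred P] (q : ℝ)
    (h : ∀ f, q * Fintype.card α ≤ (Finset.univ.filter fun a => P (Function.update f i a)).card) :
    q * Fintype.card (ι → α) ≤ (Finset.univ.filter P).card := by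
  have h1 := sum_sum_update i (fun f => if P f then (1 : ℝ) else 0)
  simp only [Finset.sum_boole] at h1
  have h2 : (Fintype.card (ι → α) : ℝ) * (q * Fintype.card α) ≤
      Fintype.card α * (Finset.univ.filter P).card := by
    rw [← h1]
    calc _ = ∑ f : ι → α, q * (Fintype.card α : ℝ) := by
          rw [Finset.sum_const, nsmul_eq_mul, Finset.card_univ]
      _ ≤ _ := Finset.sum_le_sum fun f _ => h f
  have h3 : (0 : ℝ) < Fintype.card α := by exact_mod_cast Fintype.card_pos
  refine le_of_mul_le_mul_left ?_ h3
  linarith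

/-- The probability that two given columns share at least `t` rows. -/
theorem le_card_inter_columns {n m s t b : ℕ} (hs : s ≤ m) (hs0 : 0 < s) (ht : 2 * t ≤ s)
    (hb : 0 < b) (hB : t * b ≤ s) {i j : Fin n} (hij : i ≠ j) :
    ((b : ℝ) * s / m / (4 * (1 + b * s / m))) ^ t * Fintype.card (Fin n → Support m s) ≤
      (Finset.univ.filter fun f : Fin n → Support m s => t ≤ ((f i).1 ∩ (f j).1).card).card := by
  have : Nonempty (Support m s) := by
    rw [← Fintype.card_pos_iff]
    exact_mod_cast card_support_pos hs
  refine le_card_of_update j _ _ fun f => ?_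
  simp only [Function.update_self, Function.update_of_ne hij]
  exact le_card_inter_ge hs hs0 ht hb _ (by rw [(f i).2]; exact hB)

end SparseJL

/-! ### First and second moments of the number of collisions. -/

namespace SparseJL

theorem sum_card_inter {m s : ℕ} (hs : s ≤ m) (hs0 : 0 < s) (B : Finset (Fin m)) :
    ∑ S : Support m s, ((B ∩ S.1).card : ℝ) = B.card * ((s : ℝ) / m) * Fintype.card (Support m s) := by
  have h : ∀ S : Support m s, ((B ∩ S.1).card : ℝ) = ∑ r ∈ B, if r ∈ S.1 then (1 : ℝ) else 0 := by
    intro S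
    rw [Finset.sum_boole, Finset.filter_mem_eq_inter]
  simp only [h]
  rw [Finset.sum_comm]
  simp only [Finset.sum_boole, card_supersets_singleton hs hs0, Finset.sum_const, nsmul_eq_mul]
  ring

theorem sum_card_inter_sq_le {m s : ℕ} (hs : s ≤ m) (hs0 : 0 < s) (B : Finset (Fin m)) :
    ∑ S : Support m s, ((B ∩ S.1).card : ℝ) ^ 2 ≤
      (B.card * ((s : ℝ) / m) + (B.card * ((s : ℝ) / m)) ^ 2) * Fintype.card (Support m s) := by
  have h : ∀ S : Support m s, ((B ∩ S.1).card : ℝ) ^ 2 =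
      ∑ r ∈ B, ∑ r' ∈ B, if {r, r'} ⊆ S.1 then (1 : ℝ) else 0 := by
    intro S
    rw [← Finset.filter_mem_eq_inter, ← Finset.sum_boole, sq, Finset.sum_mul_sum]
    refine Finset.sum_congr rfl fun r _ => Finset.sum_congr rfl fun r' _ => ?_
    simp only [Finset.insert_subset_iff, Finset.singleton_subset_iff]
    split_ifs <;> simp_all
  simp only [h]
  rw [Finset.sum_comm]
  have hm : 0 < m := by omega
  set p : ℝ := (s : ℝ) / m with hp
  have hp0 : 0 ≤ p := by positivity
  calc _ ≤ ∑ r ∈ B, ∑ r' ∈ B, ((if r = r' then p else 0) + p ^ 2) *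
        (Fintype.card (Support m s) : ℝ) := by
        refine Finset.sum_le_sum fun r _ => ?_
        rw [Finset.sum_comm]
        refine Finset.sum_le_sum fun r' _ => ?_
        rw [Finset.sum_boole]
        refine (card_supersets_le hs hm _).trans ?_
        gcongr
        by_cases hr : r = r'
        · simp only [hr, Finset.insert_eq_of_mem, Finset.mem_singleton, Finset.card_singleton,
            pow_one, if_true]
          linarith [sq_nonneg p]
        · simp [hr, Finset.card_pair hr, ← hp]
    _ = _ := by
        simp only [← Finset.sum_mul, Finset.sum_add_distrib, Finset.sum_const, nsmul_eq_mul]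
        congr 2
        · simp +contextual
        · ring

variable {n m s : ℕ}

/-- Given all columns but `j`, the overlap of columns `i` and `j` has mean $s^2/m$, so it is
uncorrelated with anything independent of column `j`. -/
theorem sum_card_inter_mul (hs : s ≤ m) (hs0 : 0 < s) {i j : Fin n} (hij : i ≠ j)
    (h : (Fin n → Support m s) → ℝ) (hh : ∀ f S, h (Function.update f j S) = h f) :
    ∑ f : Fin n → Support m s, (((f i).1 ∩ (f j).1).card : ℝ) * h f =
      (s : ℝ) ^ 2 / m * ∑ f, h f := by
  have h1 := sum_sum_update j
    (fun f : Fin n → Support m s => (((f i).1 ∩ (f j).1).card : ℝ) * h f)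
  simp only [Function.update_self, Function.update_of_ne hij, hh, ← Finset.sum_mul,
    sum_card_inter hs hs0] at h1
  have hN := card_support_pos hs
  have h2 : ∀ f : Fin n → Support m s, (((f i).1.card : ℝ)) = s := fun f => by rw [(f i).2]
  simp only [h2] at h1
  rw [← Finset.mul_sum] at h1
  refine mul_left_cancel₀ hN.ne' ?_
  rw [← h1]
  ring

theorem sum_card_inter_columns (hs : s ≤ m) (hs0 : 0 < s) {i j : Fin n} (hij : i ≠ j) :
    ∑ f : Fin n → Support m s, (((f i).1 ∩ (f j).1).card : ℝ) =
      (s : ℝ) ^ 2 / m * Fintype.card (Fin n → Support m s) := by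
  have := sum_card_inter_mul hs hs0 hij (fun _ => 1) (fun _ _ => rfl)
  simpa using this

theorem sum_card_inter_columns_sq_le (hs : s ≤ m) (hs0 : 0 < s) {i j : Fin n} (hij : i ≠ j) :
    ∑ f : Fin n → Support m s, (((f i).1 ∩ (f j).1).card : ℝ) ^ 2 ≤
      ((s : ℝ) ^ 2 / m + ((s : ℝ) ^ 2 / m) ^ 2) * Fintype.card (Fin n → Support m s) := by
  have h1 := sum_sum_update j
    (fun f : Fin n → Support m s => (((f i).1 ∩ (f j).1).card : ℝ) ^ 2)
  simp only [Function.update_self, Function.update_of_ne hij] at h1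
  have hN := card_support_pos hs
  refine le_of_mul_le_mul_left ?_ hN
  rw [← h1]
  calc _ ≤ ∑ f : Fin n → Support m s, ((s : ℝ) ^ 2 / m + ((s : ℝ) ^ 2 / m) ^ 2) *
        (Fintype.card (Support m s) : ℝ) := by
        refine Finset.sum_le_sum fun f _ => (sum_card_inter_sq_le hs hs0 _).trans_eq ?_
        rw [(f i).2]
        ring
    _ = _ := by
        rw [Finset.sum_const, nsmul_eq_mul, Finset.card_univ]
        ring

/-- The number of pairs of nonzero entries in a common row, over ordered pairs of distinct columns
in `K`. -/
def collisions (f : Fin n → Support m s) (K : Finset (Fin n)) : ℕ :=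
  ∑ q ∈ K.offDiag, ((f q.1).1 ∩ (f q.2).1).card

theorem sum_collisions (hs : s ≤ m) (hs0 : 0 < s) (K : Finset (Fin n)) :
    ∑ f : Fin n → Support m s, (collisions f K : ℝ) =
      K.offDiag.card * ((s : ℝ) ^ 2 / m) * Fintype.card (Fin n → Support m s) := by
  simp only [collisions, Nat.cast_sum]
  rw [Finset.sum_comm, Finset.sum_congr rfl fun q hq =>
    sum_card_inter_columns hs hs0 (Finset.mem_offDiag.1 hq).2.2]
  rw [Finset.sum_const, nsmul_eq_mul, mul_assoc]

/-- Overlaps of two different unordered pairs are uncorrelated: one pair has a column outside the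
other, and that column can be resampled. Only equal pairs contribute the extra term. -/
theorem sum_inter_mul_inter_le (hs : s ≤ m) (hs0 : 0 < s) {q q' : Fin n × Fin n}
    (hq : q.1 ≠ q.2) (hq' : q'.1 ≠ q'.2) :
    ∑ f : Fin n → Support m s,
        (((f q.1).1 ∩ (f q.2).1).card : ℝ) * ((f q'.1).1 ∩ (f q'.2).1).card ≤
      (((s : ℝ) ^ 2 / m) ^ 2 + if q' = q ∨ q' = q.swap then (s : ℝ) ^ 2 / m else 0) *
        Fintype.card (Fin n → Support m s) := by
  obtain ⟨i, j⟩ := q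
  obtain ⟨i', j'⟩ := q'
  simp only [Prod.swap_prod_mk, Prod.mk.injEq] at hq hq' ⊢
  split_ifs with h
  · have h1 := sum_card_inter_columns_sq_le (n := n) hs hs0 hq
    rw [add_comm]
    refine le_trans (le_of_eq (Finset.sum_congr rfl fun f _ => ?_)) h1
    rcases h with ⟨rfl, rfl⟩ | ⟨rfl, rfl⟩
    · ring
    · rw [Finset.inter_comm (f i').1, sq]
  · rw [add_zero]
    have hcomm : ∀ f : Fin n → Support m s,
        (((f i).1 ∩ (f j).1).card : ℝ) * ((f i').1 ∩ (f j').1).card =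
          (((f i').1 ∩ (f j').1).card : ℝ) * ((f i).1 ∩ (f j).1).card := fun f => mul_comm _ _
    by_cases hj : j' ≠ i ∧ j' ≠ j
    · rw [Finset.sum_congr rfl fun f _ => hcomm f,
        sum_card_inter_mul hs hs0 hq' (fun f => (((f i).1 ∩ (f j).1).card : ℝ)),
        sum_card_inter_columns hs hs0 hq]
      · exact le_of_eq (by ring)
      · intro f S
        rw [Function.update_of_ne hj.1.symm, Function.update_of_ne hj.2.symm]
    -- Here `j'` is `i` or `j`; as the unordered pairs differ, `i'` is the free column.
    · have hi : i' ≠ i ∧ i' ≠ j := by grind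
      rw [Finset.sum_congr rfl fun f _ => (hcomm f).trans (by rw [Finset.inter_comm (f i').1]),
        sum_card_inter_mul hs hs0 hq'.symm (fun f => (((f i).1 ∩ (f j).1).card : ℝ)),
        sum_card_inter_columns hs hs0 hq]
      · exact le_of_eq (by ring)
      · intro f S
        rw [Function.update_of_ne hi.1.symm, Function.update_of_ne hi.2.symm]

theorem sum_collisions_sq_le (hs : s ≤ m) (hs0 : 0 < s) (K : Finset (Fin n)) :
    ∑ f : Fin n → Support m s, (collisions f K : ℝ) ^ 2 ≤
      ((K.offDiag.card * ((s : ℝ) ^ 2 / m)) ^ 2 + 2 * (K.offDiag.card * ((s : ℝ) ^ 2 / m))) *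
        Fintype.card (Fin n → Support m s) := by
  simp only [collisions, Nat.cast_sum, sq (∑ q ∈ K.offDiag, _), Finset.sum_mul_sum]
  rw [Finset.sum_comm]
  set μ := (s : ℝ) ^ 2 / m with hμ
  have hμ0 : 0 ≤ μ := by positivity
  calc _ ≤ ∑ q ∈ K.offDiag, ∑ q' ∈ K.offDiag,
        (μ ^ 2 + ((if q' = q then μ else 0) + (if q' = q.swap then μ else 0))) *
          (Fintype.card (Fin n → Support m s) : ℝ) := by
        refine Finset.sum_le_sum fun q hq => ?_
        rw [Finset.sum_comm]
        refine Finset.sum_le_sum fun q' hq' => ?_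
        refine (sum_inter_mul_inter_le hs hs0 (Finset.mem_offDiag.1 hq).2.2
          (Finset.mem_offDiag.1 hq').2.2).trans ?_
        gcongr
        rw [← hμ]
        split_ifs <;> first | linarith | simp_all
    _ ≤ _ := by
        simp only [← Finset.sum_mul]
        gcongr
        calc _ ≤ ∑ q ∈ K.offDiag, ((K.offDiag.card : ℝ) * μ ^ 2 + (μ + μ)) := by
              refine Finset.sum_le_sum fun q _ => ?_
              rw [Finset.sum_add_distrib, Finset.sum_add_distrib, Finset.sum_const, nsmul_eq_mul,
                Finset.sum_ite_eq', Finset.sum_ite_eq']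
              gcongr <;> split_ifs <;> linarith
          _ = _ := by
              rw [Finset.sum_const, nsmul_eq_mul]
              ring

/-- With few expected collisions, the probability of a small positive number of collisions is
comparable to the expected number of collisions. -/
theorem le_card_few_collisions (hs : s ≤ m) (hs0 : 0 < s) (K : Finset (Fin n)) (ν : ℝ)
    (hν : ν = K.offDiag.card * ((s : ℝ) ^ 2 / m)) :
    ν / 2 * (1 - ν / 2) * Fintype.card (Fin n → Support m s) ≤
      (Finset.univ.filter fun f : Fin n → Support m s =>
        0 < collisions f K ∧ collisions f K < 4).card := by
  have h1 := sum_collisions (n := n) hs hs0 K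
  have h2 := sum_collisions_sq_le (n := n) hs hs0 K
  rw [← hν] at h1 h2
  -- Pointwise, $x-x^2/4$ is at most $1$ everywhere and nonpositive at $x=0$ and for $x\ge4$, so it
  -- minorizes the indicator of $0<x<4$. Its mean is at least $\nu-(\nu^2+2\nu)/4$.
  have h3 : ∑ f : Fin n → Support m s, ((collisions f K : ℝ) - (collisions f K : ℝ) ^ 2 / 4) ≤
      ∑ f : Fin n → Support m s,
        if 0 < collisions f K ∧ collisions f K < 4 then (1 : ℝ) else 0 := by
    refine Finset.sum_le_sum fun f _ => ?_
    generalize collisions f K = x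
    split_ifs with h
    · nlinarith [sq_nonneg ((x : ℝ) / 2 - 1)]
    · by_cases hx : x = 0
      · simp [hx]
      · have : (4 : ℝ) ≤ x := by
          have : 4 ≤ x := by omega
          exact_mod_cast this
        nlinarith
  rw [Finset.sum_boole, Finset.sum_sub_distrib, ← Finset.sum_div, h1] at h3
  linarith

end SparseJL

/-! ### Energy and the choice of signs. -/

namespace SparseJL

/-- If every element of a finite group is moved into `P` by one of the translations `H`, then `P`
has density at least the inverse of the number of translations. -/
theorem card_le_card_mul_of_translates {G ι : Type*} [Group G] [Fintype G] [Fintype ι]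
    (H : ι → G) (P : G → Prop) [DecidablePred P] (h : ∀ σ, ∃ a, P (H a * σ)) :
    Fintype.card G ≤ Fintype.card ι * (Finset.univ.filter P).card := by
  classical
  have h1 : (Finset.univ : Finset G) ⊆
      Finset.univ.biUnion fun a => (Finset.univ.filter P).image fun τ => (H a)⁻¹ * τ := by
    intro σ _
    obtain ⟨a, ha⟩ := h σ
    simp only [Finset.mem_biUnion, Finset.mem_univ, true_and, Finset.mem_image, Finset.mem_filter]
    exact ⟨a, H a * σ, ha, by simp⟩
  rw [← Finset.card_univ]
  refine (Finset.card_le_card h1).trans ?_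
  refine (Finset.card_biUnion_le_card_mul _ _ _ fun a _ => Finset.card_image_le).trans ?_
  rw [Finset.card_univ]

variable {n m s : ℕ}

/-- `s ‖A x‖²` for `x` the indicator vector of `K`, as a function of supports and signs. -/
def energy (f : Fin n → Support m s) (σ : Fin m → Fin n → ℤˣ) (K : Finset (Fin n)) : ℤ :=
  ∑ r, (∑ i ∈ K, if r ∈ (f i).1 then (σ r i : ℤ) else 0) ^ 2

theorem energy_eq (f : Fin n → Support m s) (σ : Fin m → Fin n → ℤˣ) (K : Finset (Fin n)) :
    energy f σ K = K.card * s +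
      ∑ q ∈ K.offDiag, ∑ r ∈ (f q.1).1 ∩ (f q.2).1, (σ r q.1 : ℤ) * σ r q.2 := by
  have h1 : ∀ r, (∑ i ∈ K, if r ∈ (f i).1 then (σ r i : ℤ) else 0) ^ 2 =
      (∑ i ∈ K, if r ∈ (f i).1 then (1 : ℤ) else 0) + ∑ q ∈ K.offDiag,
        if r ∈ (f q.1).1 ∩ (f q.2).1 then (σ r q.1 : ℤ) * σ r q.2 else 0 := by
    intro r
    rw [sq, Finset.sum_mul_sum, ← Finset.sum_product', ← Finset.diag_union_offDiag,
      Finset.sum_union (Finset.disjoint_diag_offDiag _), Finset.sum_diag]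
    congr 1
    · refine Finset.sum_congr rfl fun i _ => ?_
      split_ifs
      · rw [← Units.val_mul, Int.units_mul_self, Units.val_one]
      · simp
    · refine Finset.sum_congr rfl fun q _ => ?_
      simp only [Finset.mem_inter]
      split_ifs <;> simp_all
  rw [energy, Finset.sum_congr rfl fun r _ => h1 r, Finset.sum_add_distrib]
  congr 1
  · rw [Finset.sum_comm]
    simp [(f _).2]
  · rw [Finset.sum_comm]
    refine Finset.sum_congr rfl fun q _ => ?_
    rw [Finset.sum_ite_mem, Finset.univ_inter]

theorem neg_one_le_units_mul (a b : ℤˣ) : (-1 : ℤ) ≤ (a : ℤ) * b := by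
  rcases Int.units_eq_one_or a with rfl | rfl <;> rcases Int.units_eq_one_or b with rfl | rfl <;>
    simp

/-- The aligned collision counts $+1$ in both orders and each other ordered collision at least $-1$,
so the excess is at least $4-X\ge1$, with $X$ the number of ordered collisions. -/
theorem le_energy_of_aligned (f : Fin n → Support m s) (σ : Fin m → Fin n → ℤˣ)
    (K : Finset (Fin n)) (hX : collisions f K < 4) {i j : Fin n} (hi : i ∈ K) (hj : j ∈ K)
    (hij : i ≠ j) {r : Fin m} (hri : r ∈ (f i).1) (hrj : r ∈ (f j).1) (hσ : σ r i = σ r j) :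
    (K.card : ℤ) * s + 1 ≤ energy f σ K := by
  rw [energy_eq]
  have h1 : ∑ q ∈ K.offDiag, ∑ r' ∈ (f q.1).1 ∩ (f q.2).1,
      ((if q = (i, j) ∧ r' = r then (2 : ℤ) else 0) + (if q = (j, i) ∧ r' = r then 2 else 0) - 1) ≤
      ∑ q ∈ K.offDiag, ∑ r ∈ (f q.1).1 ∩ (f q.2).1, (σ r q.1 : ℤ) * σ r q.2 := by
    refine Finset.sum_le_sum fun q _ => Finset.sum_le_sum fun r' _ => ?_
    have h0 := neg_one_le_units_mul (σ r' q.1) (σ r' q.2)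
    by_cases h1 : q = (i, j) ∧ r' = r
    · obtain ⟨rfl, rfl⟩ := h1
      have : ¬ ((i, j) = (j, i) ∧ r' = r') := by
        simp [hij]
      rw [if_pos ⟨rfl, rfl⟩, if_neg this]
      simp only [hσ]
      rw [← Units.val_mul, Int.units_mul_self, Units.val_one]
      norm_num
    · by_cases h2 : q = (j, i) ∧ r' = r
      · obtain ⟨rfl, rfl⟩ := h2
        rw [if_neg h1, if_pos ⟨rfl, rfl⟩]
        simp only [hσ]
        rw [← Units.val_mul, Int.units_mul_self, Units.val_one]
        norm_num
      · rw [if_neg h1, if_neg h2]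
        simpa using h0
  have h2 : ∀ i j : Fin n, i ∈ K → j ∈ K → i ≠ j → r ∈ (f i).1 → r ∈ (f j).1 →
      ∑ q ∈ K.offDiag, ∑ r' ∈ (f q.1).1 ∩ (f q.2).1,
        (if q = (i, j) ∧ r' = r then (2 : ℤ) else 0) = 2 := by
    intro i j hi hj hij hri hrj
    rw [Finset.sum_eq_single (i, j), Finset.sum_eq_single r]
    · simp
    · intro r' _ h
      simp [h]
    · intro h
      exact absurd (Finset.mem_inter.2 ⟨hri, hrj⟩) h
    · intro q _ h
      exact Finset.sum_eq_zero fun r' _ => by simp [h]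
    · intro h
      exact absurd (Finset.mem_offDiag.2 ⟨hi, hj, hij⟩) h
  simp only [Finset.sum_sub_distrib, Finset.sum_add_distrib, h2 i j hi hj hij hri hrj,
    h2 j i hj hi hij.symm hrj hri] at h1
  have h3 : ∑ q ∈ K.offDiag, ∑ r' ∈ (f q.1).1 ∩ (f q.2).1, (1 : ℤ) = collisions f K := by
    simp [collisions]
  rw [h3] at h1
  have : (collisions f K : ℤ) < 4 := by exact_mod_cast hX
  linarith

/-- With at least one and at most three ordered collisions, at least half of the signs give a
noticeably too long image. -/
theorem card_signs_of_few_collisions (f : Fin n → Support m s) (K : Finset (Fin n))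
    (hX0 : 0 < collisions f K) (hX : collisions f K < 4) :
    Fintype.card (Fin m → Fin n → ℤˣ) ≤ 2 * (Finset.univ.filter fun σ : Fin m → Fin n → ℤˣ =>
      (K.card : ℤ) * s + 1 ≤ energy f σ K).card := by
  obtain ⟨q, hq, hq'⟩ := Finset.exists_ne_zero_of_sum_ne_zero hX0.ne'
  obtain ⟨r, hr⟩ := Finset.card_pos.1 (Nat.pos_of_ne_zero hq')
  obtain ⟨hi, hj, hij⟩ := Finset.mem_offDiag.1 hq
  obtain ⟨hri, hrj⟩ := Finset.mem_inter.1 hr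
  -- Only the sign at `(r, q.1)` is multiplied by `a`; the product of the two colliding signs is the
  -- value of `a` that aligns them.
  have := card_le_card_mul_of_translates (ι := ℤˣ)
    (fun a => Function.update (1 : Fin m → Fin n → ℤˣ) r (Function.update 1 q.1 a))
    (fun σ => (K.card : ℤ) * s + 1 ≤ energy f σ K) (fun σ => ⟨σ r q.1 * σ r q.2, by
      refine le_energy_of_aligned f _ K hX hi hj hij hri hrj ?_
      simp only [Pi.mul_apply, Function.update_self, Function.update_of_ne hij.symm, Pi.one_apply,
        one_mul]
      rw [mul_right_comm, Int.units_mul_self, one_mul]⟩)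
  simpa using this

/-- The sign change used for four columns: free signs in column `i₁` on the rows `U`, and common
signs in column `i₁` outside `U` and in the columns `i₃` and `i₄`. -/
def flip (i₁ i₃ i₄ : Fin n) (U : Finset (Fin m)) (u : U → ℤˣ) (a b c : ℤˣ) :
    Fin m → Fin n → ℤˣ := fun r i =>
  if i = i₁ then (if h : r ∈ U then u ⟨r, h⟩ else a) else if i = i₃ then b
    else if i = i₄ then c else 1

/-- If two of four columns collide in at least `t` rows, then a proportion of at least
`2 ^ (-t) / 8` of the signs aligns `t` of these rows without loss elsewhere. -/
theorem card_signs_of_inter (f : Fin n → Support m s) {i₁ i₂ i₃ i₄ : Fin n}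
    (h12 : i₁ ≠ i₂) (h13 : i₁ ≠ i₃) (h14 : i₁ ≠ i₄) (h23 : i₂ ≠ i₃) (h24 : i₂ ≠ i₄) (h34 : i₃ ≠ i₄)
    {t : ℕ} (ht : t ≤ ((f i₁).1 ∩ (f i₂).1).card) :
    Fintype.card (Fin m → Fin n → ℤˣ) ≤ 2 ^ t * 8 *
      (Finset.univ.filter fun σ : Fin m → Fin n → ℤˣ =>
        4 * (s : ℤ) + 2 * t ≤ energy f σ {i₁, i₂, i₃, i₄}).card := by
  obtain ⟨U, hU, hUt⟩ := Finset.exists_subset_card_eq ht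
  have := card_le_card_mul_of_translates (ι := (U → ℤˣ) × ℤˣ × ℤˣ × ℤˣ)
    (fun q => flip i₁ i₃ i₄ U q.1 q.2.1 q.2.2.1 q.2.2.2)
    (fun σ : Fin m → Fin n → ℤˣ => 4 * (s : ℤ) + 2 * t ≤ energy f σ {i₁, i₂, i₃, i₄})
    (fun σ => by
      by_contra! hlt
      set u : U → ℤˣ := fun r => σ r.1 i₁ * σ r.1 i₂ with hu
      have hlt' := fun a b c => hlt (u, a, b, c)
      simp only at hlt'
      set E : ℤˣ → ℤˣ → ℤˣ → ℤ := fun a b c =>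
        energy f (flip i₁ i₃ i₄ U u a b c * σ) {i₁, i₂, i₃, i₄} with hE
      -- With `u` aligning columns `i₁` and `i₂` on `U`, averaging over `a`, `b`, `c` kills every
      -- other cross term. The mean energy is exactly $4s+2t$, so the eight values cannot all be
      -- smaller.
      have hsum : E 1 1 1 + E 1 1 (-1) + E 1 (-1) 1 + E 1 (-1) (-1) + E (-1) 1 1 +
          E (-1) 1 (-1) + E (-1) (-1) 1 + E (-1) (-1) (-1) = 8 * (4 * (s : ℤ) + 2 * t) := by
        have hrow : ∀ i, ∑ r, (if r ∈ (f i).1 then (1 : ℤ) else 0) = s := by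
          intro i
          simp [(f i).2]
        have hUrow : ∑ r, (if r ∈ U then (1 : ℤ) else 0) = t := by
          simp [hUt]
        have hrhs : 8 * (4 * (s : ℤ) + 2 * t) = ∑ r, (8 * ((if r ∈ (f i₁).1 then (1 : ℤ) else 0) +
            (if r ∈ (f i₂).1 then (1 : ℤ) else 0) + (if r ∈ (f i₃).1 then (1 : ℤ) else 0) +
            (if r ∈ (f i₄).1 then (1 : ℤ) else 0)) + 16 * (if r ∈ U then (1 : ℤ) else 0)) := by
          rw [Finset.sum_add_distrib, ← Finset.mul_sum, ← Finset.mul_sum, hUrow,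
            Finset.sum_add_distrib, Finset.sum_add_distrib, Finset.sum_add_distrib,
            hrow, hrow, hrow, hrow]
          ring
        rw [hrhs]
        simp only [hE, energy, ← Finset.sum_add_distrib]
        refine Finset.sum_congr rfl fun r _ => ?_
        have hs4 : ∀ g : Fin n → ℤ, ∑ i ∈ ({i₁, i₂, i₃, i₄} : Finset (Fin n)), g i =
            g i₁ + (g i₂ + (g i₃ + g i₄)) := by
          intro g
          rw [Finset.sum_insert, Finset.sum_insert, Finset.sum_insert, Finset.sum_singleton]
          · simpa using h34
          · simpa using ⟨h23, h24⟩
          · simpa using ⟨h12, h13, h14⟩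
        simp only [hs4, Pi.mul_apply, flip, if_true, h12.symm, h13.symm, h14.symm, h23, h24,
          h34.symm, if_false, Units.val_mul]
        have hsq : ∀ v : ℤˣ, (v : ℤ) ^ 2 = 1 := fun v => by
          rw [sq, ← Units.val_mul, Int.units_mul_self, Units.val_one]
        by_cases hr : r ∈ U
        · obtain ⟨hr1, hr2⟩ := Finset.mem_inter.1 (hU hr)
          simp only [hr, hr1, hr2, dif_pos, if_true, hu, Units.val_mul, Units.val_neg, Units.val_one]
          have e1 : ((σ r i₁ : ℤ) * σ r i₂) * σ r i₁ = σ r i₂ := by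
            linear_combination (σ r i₂ : ℤ) * hsq (σ r i₁)
          rw [e1]
          split_ifs
          · linear_combination 32 * hsq (σ r i₂) + 8 * hsq (σ r i₃) + 8 * hsq (σ r i₄)
          · linear_combination 32 * hsq (σ r i₂) + 8 * hsq (σ r i₃)
          · linear_combination 32 * hsq (σ r i₂) + 8 * hsq (σ r i₄)
          · linear_combination 32 * hsq (σ r i₂)
        · have hite : ∀ i, (if r ∈ (f i).1 then (1 : ℤ) else 0) =
              (if r ∈ (f i).1 then (σ r i : ℤ) else 0) ^ 2 := fun i => by
            split_ifs
            · rw [hsq]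
            · simp
          have hmul : ∀ (i : Fin n) (v : ℤ), (if r ∈ (f i).1 then v * (σ r i : ℤ) else 0) =
              v * (if r ∈ (f i).1 then (σ r i : ℤ) else 0) := fun i v => by
            split_ifs <;> simp
          simp only [hr, hite, hmul, dif_neg, not_false_iff, if_false, Units.val_neg, Units.val_one]
          ring
      have := hlt' 1 1 1
      have := hlt' 1 1 (-1)
      have := hlt' 1 (-1) 1
      have := hlt' 1 (-1) (-1)
      have := hlt' (-1) 1 1
      have := hlt' (-1) 1 (-1)
      have := hlt' (-1) (-1) 1
      have := hlt' (-1) (-1) (-1)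
      linarith)
  simpa [hUt] using this

end SparseJL

/-! ### From energy counts to failure of norm preservation. -/

namespace SparseJL

variable {n m s : ℕ}

/-- The indicator vector of a set of coordinates. -/
def indicatorVec (K : Finset (Fin n)) : EuclideanSpace ℝ (Fin n) :=
  WithLp.toLp 2 fun i => if i ∈ K then 1 else 0

theorem norm_indicatorVec_sq (K : Finset (Fin n)) : ‖indicatorVec K‖ ^ 2 = K.card := by
  rw [EuclideanSpace.norm_sq_eq]
  simp [indicatorVec]

theorem indicatorVec_mem_ratioSet {K : Finset (Fin n)} (hK : 4 ≤ K.card) :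
    indicatorVec K ∈ ratioSet n (1 / 2) := by
  have h1 : ‖(indicatorVec K).ofLp‖ ≤ 1 := by
    rw [pi_norm_le_iff_of_nonneg zero_le_one]
    intro i
    simp only [indicatorVec]
    split_ifs <;> simp
  have h2 : (2 : ℝ) ≤ ‖indicatorVec K‖ := by
    refine (pow_le_pow_iff_left₀ zero_le_two (norm_nonneg _) two_ne_zero).1 ?_
    rw [norm_indicatorVec_sq]
    have : (4 : ℝ) ≤ K.card := by exact_mod_cast hK
    linarith
  rw [ratioSet, Set.mem_ofPred_eq]
  rw [div_le_iff₀ (by linarith)]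
  linarith

theorem norm_randMatrix_mulVec_sq (ω : Sample n m s) (K : Finset (Fin n)) :
    ‖WithLp.toLp 2 (randMatrix ω *ᵥ (indicatorVec K).ofLp)‖ ^ 2 = energy ω.1 ω.2 K / s := by
  rw [EuclideanSpace.norm_sq_eq, energy]
  push_cast
  rw [Finset.sum_div]
  refine Finset.sum_congr rfl fun r _ => ?_
  have : (randMatrix ω *ᵥ (indicatorVec K).ofLp) r =
      (∑ i ∈ K, if r ∈ (ω.1 i).1 then ((ω.2 r i : ℤ) : ℝ) else 0) / √(s : ℝ) := by
    simp only [mulVec, dotProduct, randMatrix, Matrix.of_apply, indicatorVec, eta, sigma,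
      mul_ite, mul_one, mul_zero, Finset.sum_ite_mem, Finset.univ_inter, Finset.sum_div]
    refine Finset.sum_congr rfl fun i _ => ?_
    split_ifs <;> simp
  simp only [this]
  rw [Real.norm_eq_abs, sq_abs, div_pow, Real.sq_sqrt (Nat.cast_nonneg s)]

theorem card_sample :
    Fintype.card (Sample n m s) =
      Fintype.card (Fin n → Support m s) * Fintype.card (Fin m → Fin n → ℤˣ) :=
  Fintype.card_prod _ _

/-- A lower bound for the number of samples from lower bounds for the supports and, given the
supports, for the signs. -/
theorem le_card_sample (P : (Fin n → Support m s) → (Fin m → Fin n → ℤˣ) → Prop)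
    [∀ f σ, Decidable (P f σ)]
    (Q : (Fin n → Support m s) → Prop) [DecidablePred Q] {q c : ℝ} (hc : 0 < c)
    (hQ : q * Fintype.card (Fin n → Support m s) ≤ (Finset.univ.filter Q).card)
    (hP : ∀ f, Q f → (Fintype.card (Fin m → Fin n → ℤˣ) : ℝ) ≤
      c * (Finset.univ.filter fun σ => P f σ).card) :
    q / c * Fintype.card (Sample n m s) ≤ (Finset.univ.filter fun ω : Sample n m s => P ω.1 ω.2).card := by
  have h1 : ((Finset.univ.filter fun ω : Sample n m s => P ω.1 ω.2).card : ℝ) = ∑ f : Fin n → Support m s,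
      ((Finset.univ.filter fun σ => P f σ).card : ℝ) := by
    simp only [← Finset.sum_boole]
    exact Fintype.sum_prod_type (fun ω : (Fin n → Support m s) × (Fin m → Fin n → ℤˣ) =>
      if P ω.1 ω.2 then (1 : ℝ) else 0)
  have h2 : ((Finset.univ.filter Q).card : ℝ) * (Fintype.card (Fin m → Fin n → ℤˣ) / c) ≤
      ∑ f : Fin n → Support m s, ((Finset.univ.filter fun σ => P f σ).card : ℝ) := by
    rw [← nsmul_eq_mul, ← Finset.sum_const]
    refine (Finset.sum_le_sum fun f hf => ?_).trans
      (Finset.sum_le_sum_of_subset_of_nonneg (Finset.filter_subset Q _)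
        fun f _ _ => Nat.cast_nonneg _)
    rw [div_le_iff₀' hc]
    exact hP f (Finset.mem_filter.1 hf).2
  rw [h1, card_sample]
  push_cast
  refine le_trans ?_ h2
  calc _ = q * (Fintype.card (Fin n → Support m s) : ℝ) *
        ((Fintype.card (Fin m → Fin n → ℤˣ) : ℝ) / c) := by ring
    _ ≤ _ := by gcongr

theorem not_jlCondition_of_le_card (hs : s ≤ m) (hs0 : 0 < s) {ε δ : ℝ}
    (K : Finset (Fin n)) (N : ℤ) (hN : (K.card : ℝ) * s * (1 + ε) ^ 2 < N)
    (h : δ * Fintype.card (Sample n m s) ≤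
      (Finset.univ.filter fun ω : Sample n m s => N ≤ energy ω.1 ω.2 K).card) :
    ¬ JLCondition (prob n m s) randMatrix ε δ (indicatorVec K) := by
  have hcard : (0 : ℝ) < Fintype.card (Sample n m s) := by
    have h1 : 0 < Fintype.card (Support m s) := by exact_mod_cast card_support_pos hs
    have : Nonempty (Support m s) := Fintype.card_pos_iff.1 h1
    rw [card_sample]
    exact_mod_cast Nat.mul_pos Fintype.card_pos Fintype.card_pos
  have : Nonempty (Sample n m s) := Fintype.card_pos_iff.1 (by exact_mod_cast hcard)
  have : MeasurableSingletonClass (Sample n m s) := ⟨fun _ => trivial⟩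
  have : IsProbabilityMeasure (prob n m s) := by
    unfold prob
    exact isProbabilityMeasure_uniformOn Set.finite_univ Set.univ_nonempty
  unfold JLCondition
  rw [not_lt]
  set B : Set (Sample n m s) := {ω | N ≤ energy ω.1 ω.2 K} with hB
  have hBm : MeasurableSet B := trivial
  have hPB : δ ≤ (prob n m s).real B := by
    have : (prob n m s) B = (Finset.univ.filter fun ω : Sample n m s => N ≤ energy ω.1 ω.2 K).card /
        Fintype.card (Sample n m s) := by
      unfold prob
      rw [uniformOn_univ]
      congr 1
      rw [← Measure.count_apply_finset]
      congr 1
      ext ω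
      simp [hB]
    rw [Measure.real, this, ENNReal.toReal_div]
    simp only [ENNReal.toReal_natCast]
    rwa [le_div_iff₀ hcard]
  -- Energy at least `N` violates the upper norm bound, so the good event avoids `B`.
  refine (measureReal_mono (?_ : _ ⊆ Bᶜ)).trans ?_
  · intro ω hω hωB
    have h1 := hω.2
    have h2 := pow_le_pow_left₀ (norm_nonneg _) h1 2
    rw [norm_randMatrix_mulVec_sq, mul_pow, norm_indicatorVec_sq] at h2
    have hs' : (0 : ℝ) < s := by exact_mod_cast hs0
    rw [div_le_iff₀ hs'] at h2
    have h3 : (N : ℝ) ≤ energy ω.1 ω.2 K := by exact_mod_cast hωB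
    linarith
  · rw [measureReal_compl hBm, probReal_univ]
    linarith

/-- Failure on four equal coordinates, from many collisions of two columns. -/
theorem not_jlCondition_four {t b : ℕ} (hs : s ≤ m) (ht0 : 1 ≤ t) (ht : 2 * t ≤ s) (hb : 0 < b)
    (hB : t * b ≤ s) {ε δ : ℝ} (hε : 0 < ε) (hε1 : ε < 1) (hεt : 6 * ε * s ≤ t)
    (hδ : δ ≤ ((b : ℝ) * s / m / (4 * (1 + b * s / m)) / 2) ^ t / 8)
    (hn : 4 ≤ n) :
    ∃ x ∈ ratioSet n (1 / 2), ¬ JLCondition (prob n m s) randMatrix ε δ x := by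
  have hs0 : 0 < s := by omega
  have hs' : (0 : ℝ) < s := by exact_mod_cast hs0
  set i₁ : Fin n := ⟨0, by omega⟩
  set i₂ : Fin n := ⟨1, by omega⟩
  set i₃ : Fin n := ⟨2, by omega⟩
  set i₄ : Fin n := ⟨3, by omega⟩
  have h12 : i₁ ≠ i₂ := by simp [i₁, i₂]
  have h13 : i₁ ≠ i₃ := by simp [i₁, i₃]
  have h14 : i₁ ≠ i₄ := by simp [i₁, i₄]
  have h23 : i₂ ≠ i₃ := by simp [i₂, i₃]
  have h24 : i₂ ≠ i₄ := by simp [i₂, i₄]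
  have h34 : i₃ ≠ i₄ := by simp [i₃, i₄]
  have hcard : ({i₁, i₂, i₃, i₄} : Finset (Fin n)).card = 4 := by
    rw [Finset.card_insert_of_notMem (by simp [h12, h13, h14]),
      Finset.card_insert_of_notMem (by simp [h23, h24]), Finset.card_pair h34]
  refine ⟨indicatorVec {i₁, i₂, i₃, i₄}, indicatorVec_mem_ratioSet hcard.ge, ?_⟩
  -- The threshold is exceeded because $4s(2\epsilon+\epsilon^2)<12\epsilon s\le 2t$. Columns `i₃`
  -- and `i₄` only bring the ratio down to $1/2$.
  refine not_jlCondition_of_le_card hs hs0 _ (4 * (s : ℤ) + 2 * t) ?_ ?_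
  · rw [hcard]
    push_cast
    nlinarith [mul_pos hs' hε, mul_pos (mul_pos hs' hε) (sub_pos.2 hε1)]
  · have := le_card_sample (n := n)
      (fun f σ => 4 * (s : ℤ) + 2 * t ≤ energy f σ {i₁, i₂, i₃, i₄})
      (fun f => t ≤ ((f i₁).1 ∩ (f i₂).1).card) (c := 2 ^ t * 8) (by positivity)
      (le_card_inter_columns hs hs0 ht hb hB h12)
      (fun f hf => by exact_mod_cast card_signs_of_inter f h12 h13 h14 h23 h24 h34 hf)
    refine le_trans ?_ this
    gcongr
    rw [div_pow, div_div] at hδ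
    exact hδ

/-- Failure on `k` equal coordinates, from a single collision. -/
theorem not_jlCondition_many {k : ℕ} (hs : s ≤ m) (hs0 : 0 < s) (hk : 4 ≤ k) {ε δ : ℝ} (hε : 0 < ε)
    (hε1 : ε < 1) (hεk : 3 * ε * s * k ≤ 1) (hkm : (k : ℝ) ^ 2 * (s ^ 2 / m) ≤ 1)
    (hδ : δ ≤ 3 / 32 * ((k : ℝ) ^ 2 * (s ^ 2 / m))) (hn : k ≤ n) :
    ∃ x ∈ ratioSet n (1 / 2), ¬ JLCondition (prob n m s) randMatrix ε δ x := by
  have hs' : (0 : ℝ) < s := by exact_mod_cast hs0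
  have hk' : (4 : ℝ) ≤ k := by exact_mod_cast hk
  obtain ⟨K, -, hK⟩ := Finset.exists_subset_card_eq (s := (Finset.univ : Finset (Fin n)))
    (n := k) (by simpa using hn)
  refine ⟨indicatorVec K, indicatorVec_mem_ratioSet (by omega), ?_⟩
  refine not_jlCondition_of_le_card hs hs0 _ ((K.card : ℤ) * s + 1) ?_ ?_
  · push_cast
    rw [hK]
    have h1 : (0 : ℝ) < k * s * ε := by positivity
    nlinarith [mul_pos h1 (sub_pos.2 hε1)]
  · have := le_card_sample (n := n)
      (fun f σ => (K.card : ℤ) * s + 1 ≤ energy f σ K)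
      (fun f => 0 < collisions f K ∧ collisions f K < 4) (c := 2) (by positivity)
      (le_card_few_collisions hs hs0 K _ rfl)
      (fun f hf => by exact_mod_cast card_signs_of_few_collisions f K hf.1 hf.2)
    refine le_trans ?_ this
    gcongr
    have hoff : (K.offDiag.card : ℝ) = k ^ 2 - k := by
      rw [Finset.offDiag_card, hK, Nat.cast_sub (Nat.le_mul_self k)]
      push_cast
      ring
    rw [hoff]
    set μ : ℝ := (s : ℝ) ^ 2 / m with hμ
    have hμ0 : 0 ≤ μ := by positivity
    have h1 : ((k : ℝ) ^ 2 - k) * μ ≤ 1 := by nlinarith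
    -- For $k\ge4$, $k^2-k\ge\frac34k^2$. With $\nu\le1$ the probability is at least $\nu/8$, whence
    -- $3/32$.
    have h2 : 3 / 4 * ((k : ℝ) ^ 2 * μ) ≤ ((k : ℝ) ^ 2 - k) * μ := by
      have : 3 / 4 * (k : ℝ) ^ 2 ≤ (k : ℝ) ^ 2 - k := by nlinarith
      nlinarith
    have h3 : 0 ≤ ((k : ℝ) ^ 2 - k) * μ := le_trans (by positivity) h2
    nlinarith

end SparseJL

/-! ### The three parameter regimes. -/

namespace SparseJL

variable {m s : ℕ}

theorem exists_not_jlCondition_of_sparse {ε δ L : ℝ} (hε : 0 < ε) (hε1 : ε < 1) (hL : 14 < L)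
    (hδ : δ = Real.exp (-L)) (hs0 : 0 < s) (hs : s ≤ m) (hεs : 12 * (ε * s) ≤ 1)
    (hsm : 16 * (s : ℝ) ^ 2 ≤ m) (hm : (m : ℝ) ≤ ε⁻¹ ^ 2 * Real.exp (1 / 2 * L)) :
    ∃ k, ∀ n, k ≤ n → ∃ x ∈ ratioSet n (1 / 2), ¬ JLCondition (prob n m s) randMatrix ε δ x := by
  have hs' : (0 : ℝ) < s := by exact_mod_cast hs0
  have hm' : (0 : ℝ) < m := lt_of_lt_of_le (by positivity) hsm
  have hεs0 : 0 < ε * s := by positivity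
  -- The first term lets one collision exceed the distortion; the second keeps the expected number
  -- of collisions at most one.
  set y : ℝ := min (1 / (3 * (ε * s))) (√m / s) with hy
  have hy4 : 4 ≤ y := by
    refine le_min ?_ ?_
    · rw [le_div_iff₀ (by positivity)]; linarith
    · rw [le_div_iff₀ hs']
      refine Real.le_sqrt_of_sq_le ?_
      linarith
  have hy0 : 0 ≤ y := by linarith
  set k := ⌊y⌋₊ with hk
  have hk4 : 4 ≤ k := Nat.le_floor (by exact_mod_cast hy4)
  have hky : (k : ℝ) ≤ y := Nat.floor_le hy0
  have hyk : y ≤ 2 * k := by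
    have h1 := Nat.lt_floor_add_one y
    have h2 : (4 : ℝ) ≤ k := by exact_mod_cast hk4
    linarith
  have hz : y ^ 2 * ((s : ℝ) ^ 2 / m) ≤ 1 := by
    have h1 : y * s ≤ √m := by
      have := min_le_right (1 / (3 * (ε * s))) (√m / s)
      rwa [← hy, le_div_iff₀ hs'] at this
    have h2 := pow_le_pow_left₀ (by positivity) h1 2
    rw [Real.sq_sqrt hm'.le, mul_pow] at h2
    rw [← mul_div_assoc, div_le_one hm']
    exact h2
  have hz' : Real.exp (-(1 / 2 * L)) / 9 ≤ y ^ 2 * ((s : ℝ) ^ 2 / m) := by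
    rcases min_choice (1 / (3 * (ε * s))) (√m / s) with h | h
    · rw [hy, h]
      have : (1 / (3 * (ε * s))) ^ 2 * ((s : ℝ) ^ 2 / m) = 1 / (ε ^ 2 * m) / 9 := by
        field_simp; norm_num
      rw [this, Real.exp_neg, ← one_div]
      gcongr
      rw [inv_pow, inv_mul_eq_div, le_div_iff₀ (by positivity)] at hm
      linarith
    · rw [hy, h, div_pow, Real.sq_sqrt hm'.le]
      have : (m : ℝ) / s ^ 2 * ((s : ℝ) ^ 2 / m) = 1 := by field_simp
      rw [this]
      have : Real.exp (-(1 / 2 * L)) ≤ 1 := Real.exp_le_one_iff.2 (by linarith)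
      linarith
  refine ⟨k, fun n hn => not_jlCondition_many hs hs0 hk4 hε hε1 ?_ ?_ ?_ hn⟩
  · have := hky.trans (min_le_left _ _)
    rw [le_div_iff₀ (by positivity)] at this
    linarith
  · refine le_trans ?_ hz
    gcongr
  · have h1 : y ^ 2 * ((s : ℝ) ^ 2 / m) ≤ 4 * ((k : ℝ) ^ 2 * ((s : ℝ) ^ 2 / m)) := by
      have := pow_le_pow_left₀ hy0 hyk 2
      calc _ ≤ (2 * (k : ℝ)) ^ 2 * ((s : ℝ) ^ 2 / m) := by gcongr
        _ = _ := by ring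
    have h2 : δ = Real.exp (-(1 / 2 * L)) * Real.exp (-(1 / 2 * L)) := by
      rw [hδ, ← Real.exp_add]; ring_nf
    -- The constant is $\frac{3}{32}\cdot\frac14\cdot\frac19$: the collision bound, the rounding of
    -- `y` to `k`, and the lower bound `hz'`.
    have h3 : Real.exp (-(1 / 2 * L)) ≤ 1 / 384 := by
      have h4 : (384 : ℝ) ≤ Real.exp 7 := by
        have := Real.exp_one_gt_d9
        have h7 : Real.exp 7 = Real.exp 1 ^ 7 := by rw [← Real.exp_nat_mul]; norm_num
        rw [h7]
        calc (384 : ℝ) ≤ 2.7 ^ 7 := by norm_num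
          _ ≤ _ := by gcongr; linarith
      have h5 : Real.exp 7 ≤ Real.exp (1 / 2 * L) := Real.exp_le_exp.2 (by linarith)
      rw [Real.exp_neg, ← one_div]
      exact one_div_le_one_div_of_le (by norm_num) (h4.trans h5)
    have h4 := mul_le_mul_of_nonneg_left h3 (Real.exp_pos (-(1 / 2 * L))).le
    linarith

theorem exp_neg_le {L c : ℝ} (hL : 14 < L) (hc : 16384 * c ≥ 1) : Real.exp (-L) ≤ c := by
  have h4 : (16384 : ℝ) ≤ Real.exp L := by
    have := Real.exp_one_gt_d9
    have h7 : Real.exp 14 = Real.exp 1 ^ 14 := by rw [← Real.exp_nat_mul]; norm_num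
    calc (16384 : ℝ) ≤ 2 ^ 14 := by norm_num
      _ ≤ Real.exp 14 := by rw [h7]; gcongr; linarith
      _ ≤ _ := Real.exp_le_exp.2 hL.le
  rw [Real.exp_neg, inv_le_comm₀ (Real.exp_pos _) (by linarith)]
  refine le_trans ?_ h4
  rw [inv_le_iff_one_le_mul₀ (by linarith)]
  linarith

/-- With `t = 1` and `b = s`, the mean overlap $s^2/m$ exceeds $1/16$, so failure has a constant
probability, above $e^{-14}$. -/
theorem exists_not_jlCondition_of_dense {ε δ L : ℝ} (hε : 0 < ε) (hε1 : ε < 1) (hL : 14 < L)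
    (hδ : δ = Real.exp (-L)) (hs0 : 2 ≤ s) (hs : s ≤ m) (hεs : 12 * (ε * s) ≤ 1)
    (hsm : (m : ℝ) < 16 * (s : ℝ) ^ 2) (n : ℕ) (hn : 4 ≤ n) :
    ∃ x ∈ ratioSet n (1 / 2), ¬ JLCondition (prob n m s) randMatrix ε δ x := by
  refine not_jlCondition_four (t := 1) (b := s) hs le_rfl (by omega) (by omega) (by omega) hε hε1
    ?_ ?_ hn
  · push_cast; linarith
  · have hs' : (0 : ℝ) < s := by exact_mod_cast (by omega : 0 < s)
    have hm' : (0 : ℝ) < m := by exact_mod_cast (by omega : 0 < m)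
    rw [hδ, pow_one]
    refine exp_neg_le hL ?_
    set μ : ℝ := (s : ℝ) * s / m with hμ
    have hμ1 : 1 / 16 ≤ μ := by
      rw [hμ, le_div_iff₀ hm']; linarith
    have : 1 / 68 ≤ μ / (4 * (1 + μ)) := by
      rw [div_le_div_iff₀ (by norm_num) (by positivity)]; linarith
    linarith

theorem exists_not_jlCondition_of_many_collisions {ε δ L : ℝ} (hε : 0 < ε) (hε1 : 36 * ε ≤ 1)
    (hL : 14 < L) (hδ : δ = Real.exp (-L)) (hs0 : 0 < s) (hs : s ≤ m) (hεs : 1 < 12 * (ε * s))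
    (hsL : 10 ^ 8 * (ε * s) ≤ L)
    (hm : (m : ℝ) ≤ ε⁻¹ ^ 2 * L * Real.exp (1 / 144 * L * ε⁻¹ / s)) (n : ℕ) (hn : 4 ≤ n) :
    ∃ x ∈ ratioSet n (1 / 2), ¬ JLCondition (prob n m s) randMatrix ε δ x := by
  have hs' : (0 : ℝ) < s := by exact_mod_cast hs0
  have hm' : (0 : ℝ) < m := by exact_mod_cast (by omega : 0 < m)
  have hεs0 : 0 < ε * s := by positivity
  set t := ⌈6 * (ε * s)⌉₊ with ht
  have ht0 : 1 ≤ t := Nat.one_le_ceil_iff.2 (by positivity)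
  have ht1 : 6 * (ε * s) ≤ t := Nat.le_ceil _
  -- The rounding error $1$ is absorbed by $12\epsilon s>1$.
  have ht2 : (t : ℝ) ≤ 18 * (ε * s) := by
    have := Nat.ceil_lt_add_one (a := 6 * (ε * s)) (by positivity)
    linarith
  have ht' : (0 : ℝ) < t := by exact_mod_cast ht0
  have hts' : 2 * (t : ℝ) ≤ s := by nlinarith
  have hts : 2 * t ≤ s := by exact_mod_cast hts'
  set b := s / t with hb
  have hb0 : 0 < b := Nat.div_pos (by omega) ht0
  have hb1 : (s : ℝ) ≤ 2 * t * b := by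
    have h1 : s < t * (b + 1) := Nat.lt_mul_div_succ s ht0
    have h2 : (s : ℝ) < t * (b + 1) := by exact_mod_cast h1
    linarith
  refine not_jlCondition_four (t := t) (b := b) hs ht0 hts hb0 (Nat.mul_div_le s t) hε (by linarith)
    (by linarith) ?_ hn
  set u : ℝ := L / (ε * s) with hu
  have hu8 : 10 ^ 8 ≤ u := by rwa [hu, le_div_iff₀ hεs0]
  set μ : ℝ := (b : ℝ) * s / m with hμ
  have hμ0 : 0 < μ := by positivity
  -- The size of `u`, forced by `hsL`, lets one factor $e^{u/144}$ absorb the polynomial loss in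
  -- `hμ1`; the other comes from the bound on `m`.
  have hexp : 576 * u ≤ Real.exp (u / 144) := by
    have := Real.quadratic_le_exp_of_nonneg (x := u / 144) (by positivity)
    nlinarith
  have hm2 : (m : ℝ) * (ε * 36) ≤ s * (36 * u * Real.exp (u / 144)) := by
    have e1 : 1 / 144 * L * ε⁻¹ / s = u / 144 := by rw [hu]; field_simp
    rw [e1] at hm
    calc (m : ℝ) * (ε * 36) ≤ ε⁻¹ ^ 2 * L * Real.exp (u / 144) * (ε * 36) := by gcongr
      _ = _ := by rw [hu]; field_simp
  have hμ1 : 1 ≤ μ * (36 * u * Real.exp (u / 144)) := by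
    have h1 : (m : ℝ) ≤ b * s * (36 * u * Real.exp (u / 144)) := by
      have h2 : (s : ℝ) ≤ b * (36 * (ε * s)) := by
        have hb' : (0 : ℝ) < b := by exact_mod_cast hb0
        nlinarith
      have h3 : 1 ≤ b * (36 * ε) := by
        refine le_of_mul_le_mul_right ?_ hs'
        linarith
      calc (m : ℝ) ≤ m * (b * (36 * ε)) := le_mul_of_one_le_right hm'.le h3
        _ = b * (m * (ε * 36)) := by ring
        _ ≤ b * (s * (36 * u * Real.exp (u / 144))) := by gcongr
        _ = _ := by ring
    rw [hμ, div_mul_eq_mul_div, le_div_iff₀ hm']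
    linarith
  have hsplit : Real.exp (u / 72) = Real.exp (u / 144) * Real.exp (u / 144) := by
    rw [← Real.exp_add]; ring_nf
  have hu0 : 0 < u := by linarith
  have hq : Real.exp (-(u / 72)) ≤ μ / (4 * (1 + μ)) / 2 := by
    rw [Real.exp_neg, div_div μ, ← one_div, div_le_div_iff₀ (Real.exp_pos _) (by positivity)]
    have hE : 0 < Real.exp (u / 144) := Real.exp_pos _
    have h1 : 16 ≤ μ * Real.exp (u / 72) := by
      rw [hsplit]
      calc (16 : ℝ) ≤ 16 * (μ * (36 * u * Real.exp (u / 144))) := by linarith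
        _ = μ * ((576 * u) * Real.exp (u / 144)) := by ring
        _ ≤ _ := by gcongr
    have h2 : 16 ≤ Real.exp (u / 72) := by
      rw [hsplit]; nlinarith
    nlinarith
  -- Since $t\le18\epsilon s$, the exponent $tu/72$ is at most $L/4$; the rest of `δ` pays for the
  -- factor $1/8$.
  have hpow : Real.exp (-(L / 4)) ≤ (μ / (4 * (1 + μ)) / 2) ^ t := by
    refine le_trans ?_ (pow_le_pow_left₀ (Real.exp_pos _).le hq t)
    rw [← Real.exp_nat_mul]
    apply Real.exp_le_exp.2
    have : u * (ε * s) = L := by rw [hu]; field_simp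
    nlinarith
  have hδ2 : δ = Real.exp (-(L / 4)) * Real.exp (-(3 * L / 4)) := by
    rw [hδ, ← Real.exp_add]; ring_nf
  have h8 : Real.exp (-(3 * L / 4)) ≤ 1 / 8 := by
    rw [Real.exp_neg, ← one_div]
    refine one_div_le_one_div_of_le (by norm_num) ?_
    have := Real.add_one_le_exp (3 * L / 4)
    linarith
  rw [hδ2]
  nlinarith [Real.exp_pos (-(L / 4))]

/-- The sets `ratioSet n v` grow with `v`, so one bad vector in $S_{1/2}$ excludes every $v>1/2$. -/
theorem thresholdIn_le_half {n m : ℕ} {ε δ : ℝ} {s : ℕ}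
    (h : ∃ x ∈ ratioSet n (1 / 2), ¬ JLCondition (prob n m s) randMatrix ε δ x) :
    thresholdIn n m ε δ s ≤ 1 / 2 := by
  obtain ⟨x, hx, hJ⟩ := h
  refine Real.sSup_le (fun v hv => ?_) (by norm_num)
  by_contra! hlt
  exact hJ (hv.2.2 x (le_trans hx hlt.le))

theorem threshold_le_half {n m : ℕ} {ε δ : ℝ} {s : ℕ}
    (h : ∃ x ∈ ratioSet n (1 / 2), ¬ JLCondition (prob n m s) randMatrix ε δ x) :
    threshold m ε δ s ≤ 1 / 2 := by
  obtain ⟨x, hx, hJ⟩ := h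
  refine Real.sSup_le (fun v hv => ?_) (by norm_num)
  by_contra! hlt
  exact hJ (hv.2.2 n x (le_trans hx hlt.le))

end SparseJL

theorem corollary5 :
    ∃ Cε > (0 : ℝ), ∃ Cδ > (0 : ℝ), ∃ C > (0 : ℝ), ∃ C_S > (0 : ℝ), ∃ C_L > (0 : ℝ),
      ∃ C_T > (0 : ℝ),
      ∀ (ε δ : ℝ) (s m : ℕ), 0 < ε → ε < Cε → 0 < δ → δ < Cδ →
        C ≤ (s : ℝ) → (s : ℝ) ≤ C_S * ε⁻¹ * Real.log (1 / δ) → s ≤ m →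
        (m : ℝ) ≤ min (ε⁻¹ ^ 2 * Real.exp (C_T * Real.log (1 / δ)))
          (ε⁻¹ ^ 2 * Real.log (1 / δ) * Real.exp (C_L * Real.log (1 / δ) * ε⁻¹ / (s : ℝ))) →
        SparseJL.threshold m ε δ s ≤ 1 / 2 ∧
          ∀ᶠ n : ℕ in Filter.atTop, SparseJL.thresholdIn n m ε δ s ≤ 1 / 2 := by
  -- $1/36$ ensures $2t\le s$ for many collisions, $e^{-14}$ gives $L>14$, and $2$ allows $t=1$ in
  -- the dense case. $10^{-8}$ makes `u` large, $1/144$ is its rate in the exponential, and $1/2$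
  -- leaves $e^{-L/2}$ to spare for sparse supports.
  refine ⟨1 / 36, by norm_num, Real.exp (-14), Real.exp_pos _, 2, by norm_num, 1 / 10 ^ 8,
    by norm_num, 1 / 144, by norm_num, 1 / 2, by norm_num, ?_⟩
  intro ε δ s m hε hε1 hδ hδ1 hs2 hsL hsm hm
  set L := Real.log (1 / δ) with hL
  have hLδ : Real.log δ = -L := by rw [hL, one_div, Real.log_inv, neg_neg]
  have hδL : δ = Real.exp (-L) := by rw [← hLδ, Real.exp_log hδ]
  have hL14 : 14 < L := by
    rw [hδL, Real.exp_lt_exp] at hδ1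
    linarith
  have hs2' : 2 ≤ s := by exact_mod_cast hs2
  have key : ∃ k, ∀ n, k ≤ n → ∃ x ∈ SparseJL.ratioSet n (1 / 2),
      ¬ SparseJL.JLCondition (SparseJL.prob n m s) SparseJL.randMatrix ε δ x := by
    by_cases hεs : 12 * (ε * s) ≤ 1
    · by_cases hms : 16 * (s : ℝ) ^ 2 ≤ m
      · exact SparseJL.exists_not_jlCondition_of_sparse hε (by linarith) hL14 hδL (by omega) hsm
          hεs hms (hm.trans (min_le_left _ _))
      · exact ⟨4, SparseJL.exists_not_jlCondition_of_dense hε (by linarith) hL14 hδL hs2' hsm hεs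
          (not_le.1 hms)⟩
    · refine ⟨4, SparseJL.exists_not_jlCondition_of_many_collisions hε (by linarith) hL14 hδL
        (by omega) hsm (not_le.1 hεs) ?_ (hm.trans (min_le_right _ _))⟩
      calc 10 ^ 8 * (ε * s) ≤ 10 ^ 8 * (ε * (1 / 10 ^ 8 * ε⁻¹ * L)) := by gcongr
        _ = L := by field_simp
  obtain ⟨k, hk⟩ := key
  refine ⟨SparseJL.threshold_le_half (hk k le_rfl), ?_⟩
  filter_upwards [Filter.eventually_ge_atTop k] with n hn
  exact SparseJL.thresholdIn_le_half (hk n hn)
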